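/- Let $N$ be a natural number. A real $N\times N$ matrix is called stochastic if its entries are nonnegative and each of its rows sums to $1$, and it is called an intensity matrix if its off-diagonal entries are nonnegative and each of its rows sums to $0$. A stochastic matrix $P$ is called embeddable if $P=e^{R}$ for some intensity matrix $R$. Let $P$ be a stochastic $N\times N$ matrix. Then $P$ is embeddable if and only if $P$ is nonsingular and lies in the closure (in the space of real $N\times N$ matrices with its usual topology) of the set $$\left\{(1-\varepsilon)^m (I-\varepsilon H)^{-m} \;:\; 0\le\varepsilon<1,\ m\in\mathbb{N},\ H \text{ a stochastic } N\times N \text{ matrix}\right\}.$$ -/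

import Mathlib

/-- An intensity matrix (generator of a continuous-time Markov chain on `ι`): a real square matrix
with nonnegative off-diagonal entries all of whose rows sum to `0`. -/
structure Matrix.IsIntensity {ι : Type*} [Fintype ι] (R : Matrix ι ι ℝ) : Prop where
  off_diag_nonneg : ∀ i j, i ≠ j → 0 ≤ R i j
  row_sum_eq_zero : ∀ i, ∑ j, R i j = 0

/-- A matrix `P` is embeddable if `P = exp R` for some intensity matrix `R`, so that `P` is the
transition matrix at time `1` of the Markov semigroup `t ↦ exp (t R)`. -/
def Matrix.IsEmbeddable {ι : Type*} [Fintype ι] [DecidableEq ι] (P : Matrix ι ι ℝ) : Prop :=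
  ∃ R : Matrix ι ι ℝ, R.IsIntensity ∧ P = NormedSpace.exp R

/-- The set of all matrices `(1 - ε)^m (I - ε H)^(-m)` with `0 ≤ ε < 1`, `m` a natural number and
`H` a (row) stochastic matrix. The matrix `I - ε H` is always invertible here, since `0 ≤ ε < 1`. -/
def resolventPowers (ι : Type*) [Fintype ι] [DecidableEq ι] : Set (Matrix ι ι ℝ) :=
  {B | ∃ (ε : ℝ) (m : ℕ) (H : Matrix ι ι ℝ), 0 ≤ ε ∧ ε < 1 ∧ H ∈ Matrix.rowStochastic ℝ ι ∧
    B = (1 - ε) ^ m • (1 - ε • H) ^ (-(m : ℤ))}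

/-! For stochastic `H` the series `-log (1 - ε H)` has nonnegative entries and row sums `-log (1 -
ε)`. Adding `log (1 - ε)` times the identity gives an intensity matrix, so resolvent powers are
embeddable. Conversely `exp R = lim (1 - R / n)^(-n)`, and these are resolvent powers with `H = 1 +
R / c`. It remains to pass to limits (`IsEmbeddable.of_mem_closure`): as `det (exp R) = exp (tr R)`,
a lower bound on the determinant confines the generators to a compact set. -/

open NormedSpace Filter Topology

/-! ### The logarithmic series in a Banach algebra -/

section NegLogSeries

variable {A : Type*} [NormedRing A] [NormedAlgebra ℝ A]

/-- The series `-log (1 - t x) = ∑ tⁿ⁺¹ xⁿ⁺¹ / (n + 1)`. -/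
noncomputable def negLogSeries (x : A) (t : ℝ) : A :=
  ∑' n : ℕ, (t ^ (n + 1) / (n + 1)) • x ^ (n + 1)

lemma negLogSeries_zero (x : A) : negLogSeries x 0 = 0 := by
  simp [negLogSeries]

lemma summable_norm_negLogSeries (x : A) {t : ℝ} (h : |t| * ‖x‖ < 1) :
    Summable fun n : ℕ => ‖(t ^ (n + 1) / (n + 1)) • x ^ (n + 1)‖ := by
  refine Summable.of_nonneg_of_le (fun _ => norm_nonneg _) (fun n => ?_)
    ((summable_nat_add_iff 1).2 (summable_geometric_of_lt_one (by positivity) h))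
  rw [norm_smul, mul_pow, Real.norm_eq_abs, abs_div, abs_pow]
  gcongr
  · refine div_le_self (by positivity) ?_
    rw [abs_of_pos (by positivity)]
    linarith [(Nat.cast_nonneg n : (0 : ℝ) ≤ n)]
  · exact norm_pow_le' _ n.succ_pos

lemma commute_negLogSeries {x y : A} (h : Commute y x) (t : ℝ) :
    Commute y (negLogSeries x t) :=
  Commute.tsum_right _ fun _ => (h.pow_right _).smul_right _

variable [CompleteSpace A]

lemma hasDerivAt_negLogSeries (x : A) {t : ℝ} (h : |t| * ‖x‖ < 1) :
    HasDerivAt (negLogSeries x) (x * ∑' n : ℕ, (t • x) ^ n) t := by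
  obtain ⟨r, htr, hr⟩ : ∃ r, |t| < r ∧ r * ‖x‖ < 1 := by
    have : Tendsto (fun r : ℝ => r * ‖x‖) (𝓝[>] |t|) (𝓝 (|t| * ‖x‖)) :=
      (Continuous.tendsto (by fun_prop) _).mono_left nhdsWithin_le_nhds
    exact ((eventually_mem_nhdsWithin).and (this.eventually (gt_mem_nhds h))).exists
  have hr0 : 0 < r := (abs_nonneg t).trans_lt htr
  have hsum : Summable fun n : ℕ => ‖x‖ * (r * ‖x‖) ^ n :=
    (summable_geometric_of_lt_one (by positivity) hr).mul_left _
  have key := hasDerivAt_tsum_of_isPreconnected (𝕜 := ℝ) (y₀ := 0) (y := t)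
    (g := fun (n : ℕ) (s : ℝ) => (s ^ (n + 1) / (n + 1)) • x ^ (n + 1))
    (g' := fun n s => s ^ n • x ^ (n + 1)) (t := Metric.ball 0 r) hsum Metric.isOpen_ball
    (convex_ball _ _).isPreconnected ?_ ?_ (by simpa using hr0) (by simp) (by simpa using htr)
  · have hs : Summable fun n : ℕ => (t • x) ^ n :=
      summable_geometric_of_norm_lt_one (by rwa [norm_smul, Real.norm_eq_abs])
    have he : x * ∑' n : ℕ, (t • x) ^ n = ∑' n : ℕ, t ^ n • x ^ (n + 1) := by
      rw [← hs.tsum_mul_left]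
      refine tsum_congr fun n => ?_
      rw [smul_pow, mul_smul_comm, pow_succ' x]
    rw [he]
    exact key
  · intro n s _
    refine HasDerivAt.smul_const ?_ _
    convert! (hasDerivAt_pow (n + 1) s).div_const ((n : ℝ) + 1) using 1
    push_cast
    field_simp
  · intro n s hs
    have hs' : |s| ≤ r := by simpa using (Metric.mem_ball.1 hs).le
    calc ‖s ^ n • x ^ (n + 1)‖ ≤ |s| ^ n * ‖x‖ ^ (n + 1) := by
          rw [norm_smul, Real.norm_eq_abs, abs_pow]
          gcongr
          exact norm_pow_le' _ n.succ_pos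
      _ ≤ r ^ n * ‖x‖ ^ (n + 1) := by gcongr
      _ = ‖x‖ * (r * ‖x‖) ^ n := by ring

/-- A differentiable curve in a Banach algebra whose values commute may be exponentiated. -/
lemma hasDerivAt_exp_of_commute [NormedAlgebra ℚ A] {f : ℝ → A} {f' : A} {t : ℝ}
    (hf : HasDerivAt f f' t)
    (hc : ∀ s, Commute (f t) (f s)) :
    HasDerivAt (fun s => exp (f s)) (exp (f t) * f') t := by
  -- Commutation gives `exp (f s) = exp (f t) * exp (f s - f t)`, so only the derivative of `exp` at
  -- `0` is needed.
  have h0 : HasDerivAt (fun s => exp (f s - f t)) f' t := by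
    have h1 : HasFDerivAt exp (1 : A →L[ℝ] A) (f t - f t) := by
      rw [sub_self]; exact hasFDerivAt_exp_zero
    have h2 := h1.comp_hasDerivAt t (hf.sub_const (f t))
    rw [one_apply_eq_self] at h2
    exact h2
  refine (h0.const_mul (exp (f t))).congr_of_eventuallyEq (.of_forall fun s => ?_)
  simp only
  rw [← exp_add_of_commute ((hc s).sub_right (Commute.refl _)), add_sub_cancel]

/-- The product has zero derivative on `[0, t]`, because the series has derivative `x (1 - s x)⁻¹`
and all factors commute. -/
theorem one_sub_smul_mul_exp_negLogSeries [NormedAlgebra ℚ A] (x : A) {t : ℝ}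
    (h0 : 0 ≤ t) (h : t * ‖x‖ < 1) :
    (1 - t • x) * exp (negLogSeries x t) = 1 := by
  have hs : ∀ s ∈ Set.Icc 0 t, HasDerivAt (fun s : ℝ => (1 - s • x) * exp (negLogSeries x s)) 0 s := by
    intro s hs
    have hsx : |s| * ‖x‖ < 1 := by
      rw [abs_of_nonneg hs.1]
      exact (mul_le_mul_of_nonneg_right hs.2 (norm_nonneg _)).trans_lt h
    have hcx (r : ℝ) : Commute x (negLogSeries x r) := commute_negLogSeries (Commute.refl x) r
    have h1 := hasDerivAt_exp_of_commute (hasDerivAt_negLogSeries x hsx)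
      (fun r => commute_negLogSeries (hcx s).symm r)
    have h2 : HasDerivAt (fun s : ℝ => 1 - s • x) (-x) s := by
      simpa using ((hasDerivAt_id s).smul_const x).const_sub 1
    have hg := mul_neg_geom_series (s • x) (by rwa [norm_smul, Real.norm_eq_abs])
    have hce : Commute x (exp (negLogSeries x s)) := (hcx s).exp_right
    have hc1 : Commute (1 - s • x) (exp (negLogSeries x s)) :=
      (Commute.one_left _).sub_left (hce.smul_left _)
    have hc2 : Commute (1 - s • x) x := (Commute.one_left _).sub_left ((Commute.refl x).smul_left _)
    have he : -x * exp (negLogSeries x s) + (1 - s • x) *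
        (exp (negLogSeries x s) * (x * ∑' n : ℕ, (s • x) ^ n)) = 0 := by
      rw [← mul_assoc (1 - s • x), hc1.eq, mul_assoc, ← mul_assoc (1 - s • x), hc2.eq, mul_assoc x,
        hg, mul_one, neg_mul, hce.eq, neg_add_cancel]
    rw [← he]
    exact h2.mul h1
  have := constant_of_derivWithin_zero (a := 0) (b := t)
    (fun s hs' => (hs s hs').differentiableAt.differentiableWithinAt)
    (fun s hs' => ((hs s ⟨hs'.1, hs'.2.le⟩).hasDerivWithinAt).derivWithin
      (uniqueDiffOn_Icc (hs'.1.trans_lt hs'.2) _ ⟨hs'.1, hs'.2.le⟩)) t ⟨h0, le_rfl⟩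
  simpa [negLogSeries_zero] using this

lemma tendsto_nsmul_negLogSeries (x : A) :
    Tendsto (fun n : ℕ => n • negLogSeries x (n : ℝ)⁻¹) atTop (𝓝 x) := by
  have h := hasDerivAt_negLogSeries x (t := 0) (by simp)
  have hx : x * ∑' n : ℕ, ((0 : ℝ) • x) ^ n = x := by
    rw [tsum_eq_single 0 (by intro n hn; simp [hn])]
    simp
  rw [hx, hasDerivAt_iff_tendsto_slope] at h
  have ht : Tendsto (fun n : ℕ => (n : ℝ)⁻¹) atTop (𝓝[≠] 0) :=
    tendsto_nhdsWithin_iff.2 ⟨tendsto_inv_atTop_nhds_zero_nat,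
      (eventually_ne_atTop 0).mono fun n hn => by simpa using hn⟩
  refine (h.comp ht).congr fun n => ?_
  simp [slope, negLogSeries_zero, Nat.cast_smul_eq_nsmul]
end NegLogSeries

/-! ### Resolvent powers and embeddable matrices -/

namespace Matrix

open scoped Matrix.Norms.Operator
variable {ι : Type*} [Fintype ι]

lemma IsIntensity.nsmul {R : Matrix ι ι ℝ} (hR : R.IsIntensity) (n : ℕ) :
    (n • R).IsIntensity := by
  refine ⟨fun i j hij => ?_, fun i => ?_⟩
  · simpa using mul_nonneg n.cast_nonneg (hR.off_diag_nonneg i j hij)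
  · simp [← Finset.mul_sum, hR.row_sum_eq_zero i]

variable [DecidableEq ι]

lemma norm_le_one_of_mem_rowStochastic {H : Matrix ι ι ℝ} (hH : H ∈ rowStochastic ℝ ι) :
    ‖H‖ ≤ 1 := by
  rw [linfty_opNorm_def, ← NNReal.coe_one, NNReal.coe_le_coe]
  refine Finset.sup_le fun i _ => ?_
  rw [← NNReal.coe_le_coe, NNReal.coe_sum, NNReal.coe_one, ← sum_row_of_mem_rowStochastic hH i]
  exact (Finset.sum_congr rfl fun j _ => abs_of_nonneg (nonneg_of_mem_rowStochastic hH)).le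

lemma hasSum_negLogSeries_apply {R : Matrix ι ι ℝ} {t : ℝ} (h : |t| * ‖R‖ < 1) (i j : ι) :
    HasSum (fun n : ℕ => t ^ (n + 1) / (n + 1) * (R ^ (n + 1)) i j) (negLogSeries R t i j) :=
  Pi.hasSum.1 (Pi.hasSum.1 (summable_norm_negLogSeries R h).of_norm.hasSum i) j

lemma isIntensity_negLogSeries_add {H : Matrix ι ι ℝ} (hH : H ∈ rowStochastic ℝ ι) {ε : ℝ}
    (h0 : 0 ≤ ε) (h1 : ε < 1) : (negLogSeries H ε + Real.log (1 - ε) • 1).IsIntensity := by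
  have hn : |ε| * ‖H‖ < 1 := by
    rw [abs_of_nonneg h0]
    exact (mul_le_of_le_one_right h0 (norm_le_one_of_mem_rowStochastic hH)).trans_lt h1
  have hpow (n : ℕ) : H ^ n ∈ rowStochastic ℝ ι := pow_mem hH n
  refine ⟨fun i j hij => ?_, fun i => ?_⟩
  · have : 0 ≤ negLogSeries H ε i j := (hasSum_negLogSeries_apply hn i j).nonneg fun n =>
      mul_nonneg (by positivity) (nonneg_of_mem_rowStochastic (hpow _))
    simpa [one_apply_ne hij] using this
  · have hs := hasSum_sum fun j (_ : j ∈ Finset.univ) => hasSum_negLogSeries_apply hn i j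
    simp only [← Finset.mul_sum, sum_row_of_mem_rowStochastic (hpow _), mul_one] at hs
    have := hs.unique (Real.hasSum_pow_div_log_of_abs_lt_one (by rwa [abs_of_nonneg h0]))
    simp [Finset.sum_add_distrib, this, one_apply]

lemma exp_add_smul_one (R : Matrix ι ι ℝ) (a : ℝ) :
    exp (R + a • 1) = Real.exp a • exp R := by
  have h1 : exp (a • (1 : Matrix ι ι ℝ)) = Real.exp a • 1 := by
    rw [← Algebra.algebraMap_eq_smul_one, ← Algebra.algebraMap_eq_smul_one, Real.exp_eq_exp_ℝ]
    exact (algebraMap_exp_comm a).symm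
  rw [Matrix.exp_add_of_commute _ _ ((Commute.one_right R).smul_right a), h1, mul_smul_comm,
    mul_one]

lemma zpow_neg_eq_of_mul_eq_one {A B : Matrix ι ι ℝ} (h : A * B = 1) (m : ℕ) :
    A ^ (-(m : ℤ)) = B ^ m := by
  have hc : Commute A B := h.trans (mul_eq_one_comm.1 h).symm
  rw [zpow_neg_natCast]
  exact inv_eq_right_inv (by rw [← hc.mul_pow, h, one_pow])

/-- Every `(1 - ε)^m (1 - ε H)^(-m)` is embeddable. -/
theorem isEmbeddable_of_mem_resolventPowers {B : Matrix ι ι ℝ} (hB : B ∈ resolventPowers ι) :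
    B.IsEmbeddable := by
  obtain ⟨ε, m, H, h0, h1, hH, rfl⟩ := hB
  refine ⟨_, (isIntensity_negLogSeries_add hH h0 h1).nsmul m, ?_⟩
  have hinv : (1 - ε • H) * exp (negLogSeries H ε) = 1 := one_sub_smul_mul_exp_negLogSeries H h0
    ((mul_le_of_le_one_right h0 (norm_le_one_of_mem_rowStochastic hH)).trans_lt h1)
  rw [Matrix.exp_nsmul, exp_add_smul_one, Real.exp_log (by linarith), smul_pow,
    zpow_neg_eq_of_mul_eq_one hinv]

lemma tendsto_exp_nsmul_negLogSeries (R : Matrix ι ι ℝ) :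
    Tendsto (fun n : ℕ => exp (n • negLogSeries R (n : ℝ)⁻¹)) atTop (𝓝 (exp R)) :=
  (tendsto_nsmul_negLogSeries R).exp

lemma one_sub_inv_smul_mul_exp {R : Matrix ι ι ℝ} {n : ℕ} (hn : ‖R‖ < n) :
    (1 - (n : ℝ)⁻¹ • R) * exp (negLogSeries R (n : ℝ)⁻¹) = 1 := by
  have hn0 : (0 : ℝ) < n := (norm_nonneg R).trans_lt hn
  refine one_sub_smul_mul_exp_negLogSeries R (by positivity) ?_
  rwa [inv_mul_lt_iff₀ hn0, mul_one]

lemma eventually_norm_lt_natCast (R : Matrix ι ι ℝ) : ∀ᶠ n : ℕ in atTop, ‖R‖ < n :=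
  tendsto_natCast_atTop_atTop.eventually_gt_atTop _

/-- An embeddable matrix `exp R` is the limit of `(1 - R / n)^(-n)`. -/
theorem IsIntensity.exp_mem_closure_resolventPowers {R : Matrix ι ι ℝ} (hR : R.IsIntensity) :
    exp R ∈ closure (resolventPowers ι) := by
  refine mem_closure_of_tendsto (tendsto_exp_nsmul_negLogSeries R) ?_
  filter_upwards [eventually_norm_lt_natCast R] with n hn
  have hn0 : (0 : ℝ) < n := (norm_nonneg R).trans_lt hn
  -- Uniformization: such a `c` makes `1 + R / c` stochastic.
  obtain ⟨c, hc0, hc⟩ : ∃ c : ℝ, 0 < c ∧ ∀ i, -R i i ≤ c := by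
    refine ⟨1 + ∑ i, |R i i|, by positivity, fun i => ?_⟩
    have := Finset.single_le_sum (f := fun i => |R i i|) (fun _ _ => abs_nonneg _)
      (Finset.mem_univ i)
    linarith [neg_le_abs (R i i)]
  have hH : 1 + c⁻¹ • R ∈ rowStochastic ℝ ι := by
    refine mem_rowStochastic_iff_sum.2 ⟨fun i j => ?_, fun i => ?_⟩
    · rcases eq_or_ne i j with rfl | hij
      · have : c⁻¹ * (-R i i) ≤ 1 := by
          rw [inv_mul_le_iff₀ hc0, mul_one]; exact hc i
        simp only [add_apply, one_apply_eq, smul_apply, smul_eq_mul]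
        linarith
      · simpa [one_apply_ne hij] using mul_nonneg (inv_nonneg.2 hc0.le) (hR.off_diag_nonneg i j hij)
    · simp [Finset.sum_add_distrib, one_apply, ← Finset.mul_sum, hR.row_sum_eq_zero i]
  have hε : 1 - c / (n + c) = n / (n + c) := by field_simp; ring
  -- This `ε` makes `1 - ε H` equal to `(1 - ε) (1 - R / n)`, so the scalar powers cancel.
  refine ⟨c / (n + c), n, _, by positivity, by rw [div_lt_one (by positivity)]; linarith, hH, ?_⟩
  have he : 1 - (c / (n + c)) • (1 + c⁻¹ • R) =
      ((n : ℝ) / (n + c)) • (1 - (n : ℝ)⁻¹ • R) := by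
    rw [← hε, smul_add, smul_sub, sub_smul, one_smul, smul_smul, smul_smul, hε]
    have h1 : c / (n + c) * c⁻¹ = (n + c)⁻¹ := by field_simp
    have h2 : (n : ℝ) / (n + c) * (n : ℝ)⁻¹ = (n + c)⁻¹ := by field_simp
    rw [h1, h2]
    abel
  have hinv : (1 - (c / (n + c)) • (1 + c⁻¹ • R)) *
      (((n : ℝ) / (n + c))⁻¹ • exp (negLogSeries R (n : ℝ)⁻¹)) = 1 := by
    rw [he, smul_mul_smul_comm, one_sub_inv_smul_mul_exp hn, mul_inv_cancel₀ (by positivity),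
      one_smul]
  rw [zpow_neg_eq_of_mul_eq_one hinv, hε, smul_pow, smul_smul, inv_pow,
    mul_inv_cancel₀ (by positivity), one_smul, Matrix.exp_nsmul]

/-! ### Determinants and compactness -/

theorem det_exp_real (R : Matrix ι ι ℝ) : (exp R).det = Real.exp R.trace := by
  have h1 : Tendsto (fun n : ℕ => (exp (n • negLogSeries R (n : ℝ)⁻¹)).det) atTop
      (𝓝 (exp R).det) :=
    ((Continuous.matrix_det continuous_id).tendsto _).comp (tendsto_exp_nsmul_negLogSeries R)
  -- Remainder in `det (1 - s R) = 1 - s tr R + s² p(s)`.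
  set p := (1 + (Polynomial.X : Polynomial ℝ) • (-R).map Polynomial.C).det.divX.divX with hp
  have hinv : Tendsto (fun n : ℕ => (n : ℝ)⁻¹) atTop (𝓝 0) := tendsto_inv_atTop_nhds_zero_nat
  have h2 : Tendsto (fun n : ℕ => (1 - (n : ℝ)⁻¹ • R).det ^ n) atTop
      (𝓝 (Real.exp (-R.trace))) := by
    have ht : Tendsto (fun n : ℕ => (n : ℝ) * ((-R).trace * (n : ℝ)⁻¹ +
        p.eval (n : ℝ)⁻¹ * (n : ℝ)⁻¹ ^ 2)) atTop (𝓝 (-R.trace)) := by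
      have : Tendsto (fun n : ℕ => -R.trace + p.eval (n : ℝ)⁻¹ * (n : ℝ)⁻¹) atTop
          (𝓝 (-R.trace + p.eval 0 * 0)) :=
        (((p.continuous.tendsto 0).comp hinv).mul hinv).const_add _
      rw [mul_zero, add_zero] at this
      refine this.congr' ?_
      filter_upwards [eventually_ne_atTop 0] with n hn
      have : (n : ℝ) ≠ 0 := by exact_mod_cast hn
      rw [trace_neg]
      field_simp
    refine (Real.tendsto_one_add_pow_exp_of_tendsto ht).congr fun n => ?_
    rw [sub_eq_add_neg, ← smul_neg, det_one_add_smul, add_assoc]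
  have h3 := h2.mul h1
  have h4 : Tendsto (fun _ : ℕ => (1 : ℝ)) atTop (𝓝 (Real.exp (-R.trace) * (exp R).det)) := by
    refine h3.congr' ?_
    filter_upwards [eventually_norm_lt_natCast R] with n hn
    rw [Matrix.exp_nsmul, det_pow, ← mul_pow, ← det_mul, one_sub_inv_smul_mul_exp hn, det_one,
      one_pow]
  have h5 := tendsto_nhds_unique h4 tendsto_const_nhds
  rw [Real.exp_neg, inv_mul_eq_one₀ (Real.exp_ne_zero _)] at h5
  exact h5.symm

lemma IsIntensity.diag_nonpos {R : Matrix ι ι ℝ} (hR : R.IsIntensity) (i : ι) : R i i ≤ 0 := by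
  have h := hR.row_sum_eq_zero i
  rw [← Finset.add_sum_erase _ _ (Finset.mem_univ i)] at h
  have := Finset.sum_nonneg fun j (hj : j ∈ Finset.univ.erase i) =>
    hR.off_diag_nonneg i j (Finset.ne_of_mem_erase hj).symm
  linarith

/-- Zero row sums bound each off-diagonal entry by `-R i i`, one of the nonnegative summands of
`-R.trace`. -/
lemma IsIntensity.abs_le_neg_trace {R : Matrix ι ι ℝ} (hR : R.IsIntensity) (i j : ι) :
    |R i j| ≤ -R.trace := by
  have hd : -R i i ≤ -R.trace := by
    rw [trace, ← Finset.sum_neg_distrib]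
    exact Finset.single_le_sum (f := fun i => -R.diag i)
      (fun k _ => neg_nonneg.2 (hR.diag_nonpos k)) (Finset.mem_univ i)
  rcases eq_or_ne i j with rfl | hij
  · rwa [abs_of_nonpos (hR.diag_nonpos i)]
  · refine le_trans ?_ hd
    rw [abs_of_nonneg (hR.off_diag_nonneg i j hij)]
    have h := hR.row_sum_eq_zero i
    rw [← Finset.add_sum_erase _ _ (Finset.mem_univ i)] at h
    have := Finset.single_le_sum (f := fun j => R i j) (fun k hk =>
      hR.off_diag_nonneg i k (Finset.ne_of_mem_erase hk).symm)
      (Finset.mem_erase.2 ⟨hij.symm, Finset.mem_univ j⟩)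
    linarith

lemma isCompact_setOf_isIntensity_trace_ge (c : ℝ) :
    IsCompact {R : Matrix ι ι ℝ | R.IsIntensity ∧ c ≤ R.trace} := by
  have hK : IsCompact (Set.univ.pi fun _ : ι => Set.univ.pi fun _ : ι => Set.Icc c (-c)) :=
    isCompact_univ_pi fun _ => isCompact_univ_pi fun _ => isCompact_Icc
  refine hK.of_isClosed_subset ?_ fun R hR i _ j _ => ?_
  · have : {R : Matrix ι ι ℝ | R.IsIntensity ∧ c ≤ R.trace} =
        (⋂ (i) (j) (_ : i ≠ j), {R | 0 ≤ R i j}) ∩ (⋂ i, {R | ∑ j, R i j = 0}) ∩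
          {R | c ≤ R.trace} := by
      ext R
      simp only [Set.mem_inter_iff, Set.mem_iInter, Set.mem_ofPred_eq]
      exact and_congr_left' ⟨fun h => ⟨h.1, h.2⟩, fun h => ⟨h.1, h.2⟩⟩
    rw [this]
    refine ((isClosed_iInter fun i => isClosed_iInter fun j => isClosed_iInter fun _ => ?_).inter
      (isClosed_iInter fun i => ?_)).inter ?_
    · exact isClosed_le continuous_const (continuous_id.matrix_elem i j)
    · exact isClosed_eq (continuous_finsetSum _ fun j _ => continuous_id.matrix_elem i j)
        continuous_const
    · exact isClosed_le continuous_const (Continuous.matrix_trace continuous_id)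
  · have h := abs_le.1 (hR.1.abs_le_neg_trace i j)
    exact ⟨by linarith [h.1, hR.2], by linarith [h.2, hR.2]⟩

/-- The embeddable matrices are relatively closed in the nonsingular matrices. -/
theorem IsEmbeddable.of_mem_closure {P : Matrix ι ι ℝ} (hP : IsUnit P)
    (h : P ∈ closure {B : Matrix ι ι ℝ | B.IsEmbeddable}) : P.IsEmbeddable := by
  have hdet : P.det ≠ 0 := ((isUnit_iff_isUnit_det P).1 hP).ne_zero
  -- The strict bound `d < |det|` is open, so it may be imposed on the approximants of `P`.
  obtain ⟨d, hd0, hd⟩ := exists_between (abs_pos.2 hdet)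
  have hU : IsOpen {B : Matrix ι ι ℝ | d < |B.det|} :=
    isOpen_lt continuous_const (Continuous.matrix_det continuous_id).abs
  have hcl : IsClosed (exp '' {R : Matrix ι ι ℝ | R.IsIntensity ∧ Real.log d ≤ R.trace}) :=
    ((isCompact_setOf_isIntensity_trace_ge _).image exp_continuous).isClosed
  have hsub : {B : Matrix ι ι ℝ | d < |B.det|} ∩ {B | B.IsEmbeddable} ⊆
      exp '' {R : Matrix ι ι ℝ | R.IsIntensity ∧ Real.log d ≤ R.trace} := by
    rintro _ ⟨hB, R, hR, rfl⟩
    refine ⟨R, ⟨hR, ?_⟩, rfl⟩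
    rw [Set.mem_ofPred_eq, det_exp_real, abs_of_pos (Real.exp_pos _)] at hB
    exact ((Real.log_lt_iff_lt_exp hd0).2 hB).le
  obtain ⟨R, hR, rfl⟩ := closure_minimal hsub hcl (hU.inter_closure ⟨hd, h⟩)
  exact ⟨R, hR.1, rfl⟩

end Matrix

theorem mainTheorem7 {ι : Type*} [Fintype ι] [DecidableEq ι] (P : Matrix ι ι ℝ)
    (hP : P ∈ Matrix.rowStochastic ℝ ι) :
    P.IsEmbeddable ↔ (IsUnit P ∧ P ∈ closure (resolventPowers ι)) := by
  refine ⟨?_, fun ⟨h1, h2⟩ => Matrix.IsEmbeddable.of_mem_closure h1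
    (closure_mono (fun _ => Matrix.isEmbeddable_of_mem_resolventPowers) h2)⟩
  rintro ⟨R, hR, rfl⟩
  exact ⟨Matrix.isUnit_exp R, hR.exp_mem_closure_resolventPowers⟩
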